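/- Let $\mathcal X$ be a set, $x_1,\dots,x_n\in\mathcal X$ ($n\ge 1$) fixed inputs, and $\psi_1,\dots,\psi_p:\mathcal X\to\mathbb R$ feature maps. For $f:\mathcal X\to\mathbb R$ put $\|f\|_n^2:=\frac1n\sum_{i=1}^n f(x_i)^2$, and for $\beta\in\mathbb R^p$ put $f_\beta:=\sum_{j=1}^p\psi_j\beta_j$ and $\|\beta\|_1:=\sum_{j=1}^p|\beta_j|$. For $\delta>0$ and a class $\mathcal F$ of functions $\mathcal X\to\mathbb R$, let $N(\delta,\mathcal F,\|\cdot\|_n)$ be the smallest $N$ for which there are functions $\phi_1,\dots,\phi_N:\mathcal X\to\mathbb R$ (not necessarily in $\mathcal F$) with $\min_{k}\|f-\phi_k\|_n\le\delta$ for all $f\in\mathcal F$. Assume $\|\psi_j\|_n\le 1$ for all $j$. Then $\|f_\beta\|_n\le\|\beta\|_1$ for all $\beta\in\mathbb R^p$; hence $\{f_\beta/\|\beta\|_1:\ \beta\in\mathbb R^p,\ \beta\neq 0\}$ is a class of functions with $\|\cdot\|_n$-norm at most $1$. Suppose moreover that for some $0<\alpha<1$ and some $A>0$ $$\log\bigl(1+2N(\delta,\{f_\beta:\|\beta\|_1=1\},\|\cdot\|_n)\bigr)\le\Bigl(\frac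 A\delta\Bigr)^{2\alpha},\qquad 0<\delta\le 1 .$$ Let the errors $\epsilon_1,\dots,\epsilon_n$ be independent real random variables with mean zero that are sub-Gaussian: for some constants $K,\sigma_0>0$, $$K^2\bigl(\mathbb E\exp[\epsilon_i^2/K^2]-1\bigr)\le\sigma_0^2,\qquad i=1,\dots,n .$$ Put $$B:=\exp\Bigl[\frac{A^{2\alpha}\alpha}{2(2^{1-\alpha}-1)^2}\Bigr]-1,\qquad K_0:=3\times 2^5\sqrt{K^2+\sigma_0^2},$$ and, for $t>0$, $$\lambda_0:=\frac{4K_0}{\sqrt n}\Bigl(\frac{A^\alpha}{2^{1-\alpha}-1}+t\Bigr),\qquad \mathcal T_\alpha:=\Bigl\{\sup_{\beta\in\mathbb R^p}\frac{4\,|\epsilon^Tf_\beta|/n}{\|f_\beta\|_n^{1-\alpha}\|\beta\|_1^{\alpha}}\le\lambda_0\Bigr\},$$ where $\epsilon^Tf_\beta:=\sum_{i=1}^n\epsilon_if_\beta(x_i)$ and the quotient is read as $0$ when $\|f_\beta\|_n=0$ (its numerator is then $0$). Then for all $t>0$ $$\mathbb P(\mathcal T_\alpha)\ge 1-\exp[-t^2]\,(1+2/B).$$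 -/

import Mathlib

open MeasureTheory ProbabilityTheory
open scoped ENNReal

noncomputable section

namespace LassoDesign

variable {𝒳 : Type*} {n p : ℕ}

/-- The empirical norm `‖f‖_n = (∑ᵢ f(xᵢ)² / n)^{1/2}` of a function on the input space. -/
def empNorm (x : Fin n → 𝒳) (f : 𝒳 → ℝ) : ℝ :=
  Real.sqrt ((∑ i, f (x i) ^ 2) / n)

/-- The linear function `f_β = ∑ⱼ ψⱼ βⱼ`. -/
def linFun (ψ : Fin p → 𝒳 → ℝ) (β : Fin p → ℝ) : 𝒳 → ℝ :=
  fun z => ∑ j, ψ j z * β j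

/-- The `ℓ₁`-norm of a coefficient vector. -/
def l1Norm (β : Fin p → ℝ) : ℝ := ∑ j, |β j|

/-- The class `{f_β : ‖β‖₁ = 1}`. -/
def unitClass (ψ : Fin p → 𝒳 → ℝ) : Set (𝒳 → ℝ) :=
  {f | ∃ β : Fin p → ℝ, l1Norm β = 1 ∧ f = linFun ψ β}

/-- A finite set `C` of functions (not required to lie in `F`) is a `δ`-covering set of `F`. -/
def IsCovering (x : Fin n → 𝒳) (δ : ℝ) (F : Set (𝒳 → ℝ)) (C : Finset (𝒳 → ℝ)) : Prop :=
  ∀ f ∈ F, ∃ φ ∈ C, empNorm x (f - φ) ≤ δ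

/-- The `δ`-covering number `N(δ, F, ‖·‖_n)`: the minimum size of a `δ`-covering set
(`⊤` if there is no finite one). -/
def coveringNumber (x : Fin n → 𝒳) (δ : ℝ) (F : Set (𝒳 → ℝ)) : ℕ∞ :=
  ⨅ (C : Finset (𝒳 → ℝ)) (_ : IsCovering x δ F C), (C.card : ℕ∞)

/-- The entropy condition `log (1 + 2 N(δ, F, ‖·‖_n)) ≤ (A/δ)^{2α}` for `0 < δ ≤ 1`;
the left-hand side is `⊤` where the covering number is infinite. -/
def EntropyBound (x : Fin n → 𝒳) (F : Set (𝒳 → ℝ)) (A α : ℝ) : Prop :=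
  ∀ δ : ℝ, 0 < δ → δ ≤ 1 →
    ENNReal.log (1 + 2 * (coveringNumber x δ F : ℝ≥0∞)) ≤ (((A / δ) ^ (2 * α) : ℝ) : EReal)

/-- Sub-Gaussian errors: `K² (𝔼 exp[εᵢ²/K²] - 1) ≤ σ₀²` for all `i`, the expectation
being finite. -/
def SubGaussianErrors {Ω : Type*} [MeasurableSpace Ω] (μ : Measure Ω)
    (ε : Fin n → Ω → ℝ) (K σ₀ : ℝ) : Prop :=
  ∀ i, Integrable (fun ω => Real.exp (ε i ω ^ 2 / K ^ 2)) μ ∧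
    K ^ 2 * ((∫ ω, Real.exp (ε i ω ^ 2 / K ^ 2) ∂μ) - 1) ≤ σ₀ ^ 2

/-- `K₀ = 3 · 2⁵ · √(K² + σ₀²)`. -/
def K₀ (K σ₀ : ℝ) : ℝ := 3 * 2 ^ 5 * Real.sqrt (K ^ 2 + σ₀ ^ 2)

/-- `B = exp[A^{2α} α / (2 (2^{1-α} - 1)²)] - 1`. -/
def B (A α : ℝ) : ℝ :=
  Real.exp (A ^ (2 * α) * α / (2 * ((2 : ℝ) ^ (1 - α) - 1) ^ 2)) - 1

/-- `λ₀ = (4 K₀ / √n) (A^α / (2^{1-α} - 1) + t)`. -/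
def lam₀ (n : ℕ) (K σ₀ A α t : ℝ) : ℝ :=
  4 * K₀ K σ₀ / Real.sqrt n * (A ^ α / ((2 : ℝ) ^ (1 - α) - 1) + t)

/-- The event `𝒯_α`: `sup_β (4 |εᵀ f_β| / n) / (‖f_β‖_n^{1-α} ‖β‖₁^α) ≤ l`. The supremum is taken
in the extended reals. Where the denominator vanishes (for `0 < α < 1`: where `f_β` vanishes at
all inputs), the numerator vanishes too, and the quotient is read as `0`. -/
def eventT {Ω : Type*} (x : Fin n → 𝒳) (ψ : Fin p → 𝒳 → ℝ) (ε : Fin n → Ω → ℝ)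
    (α l : ℝ) : Set Ω :=
  {ω | (⨆ β : Fin p → ℝ,
      ((4 * |∑ i, ε i ω * linFun ψ β (x i)| / n /
        (empNorm x (linFun ψ β) ^ (1 - α) * l1Norm β ^ α) : ℝ) : EReal)) ≤ (l : EReal)}

end LassoDesign

end

/-! The quotient in `eventT` is invariant under scaling of `β`, so it suffices to bound `|εᵀf|` by a
multiple of `√n ‖f‖_n^(1-α)` uniformly over `unitClass ψ`, where `‖f‖_n ≤ 1`. This is done by
peeling and chaining.

In the shell `‖f‖_n ≤ 2⁻ˢ` the origin is already a `2⁻ˢ`-approximation, so chains start there and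
run through the nets of radius `2^(-(s+k))`. With `a = 2^α` and `b = A^α`, the entropy at scale
`2⁻ᵐ` is at most `(b aᵐ)²`. Since `a < 2`, the link contributions `2^(-(s+j+1)) * linkDeviation` sum
to order `(a/2)ˢ = (2⁻ˢ)^(1-α)`, which is the required power of the norm (`sum_linkDeviation_le`).

The square of `linkDeviation` pays for the union bound (`linkDeviation_sq_ge`): link `j` of shell
`s` fails with probability at most `e^(-t²) (1+B)⁻ˢ 2^(-(j+1))`. Summing over `j` and `s` gives
`e^(-t²) (1 + 1/B)`, slightly better than claimed. The tail of each increment comes from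
`measureReal_abs_weighted_sum_ge_le`. -/

namespace LassoDesign

/-! ### Sub-Gaussian moment generating functions and tails of weighted sums. -/

section SubGaussian

variable {Ω : Type*} [MeasurableSpace Ω] {μ : Measure Ω}

theorem exp_le_add_exp_sq (y : ℝ) : Real.exp y ≤ y + Real.exp (y ^ 2) := by
  have h1 : y ^ 2 + 1 ≤ Real.exp (y ^ 2) := Real.add_one_le_exp _
  rcases le_total |y| 1 with h | h
  · have := (abs_le.1 (Real.abs_exp_sub_one_sub_id_le h)).2
    linarith
  · rcases le_total 0 y with hy | hy
    · rw [abs_of_nonneg hy] at h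
      have : Real.exp y ≤ Real.exp (y ^ 2) := Real.exp_le_exp.2 (by nlinarith)
      linarith
    · rw [abs_of_nonpos hy] at h
      have : Real.exp y ≤ 1 := Real.exp_le_one_iff.2 hy
      nlinarith

theorem exp_mul_le_one_add_mul {θ : ℝ} (h0 : 0 ≤ θ) (h1 : θ ≤ 1) (z : ℝ) :
    Real.exp (θ * z) ≤ 1 + θ * (Real.exp z - 1) := by
  have := convexOn_exp.2 (Set.mem_univ z) (Set.mem_univ 0) h0 (sub_nonneg.2 h1) (by ring)
  simp only [smul_eq_mul, mul_zero, add_zero, Real.exp_zero, mul_one] at this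
  linarith

theorem integrable_of_integrable_exp_sq {X : Ω → ℝ} {K : ℝ} (hK : 0 < K) (hX : Measurable X)
    (hint : Integrable (fun ω => Real.exp (X ω ^ 2 / K ^ 2)) μ) : Integrable X μ := by
  refine (hint.const_mul K).mono' hX.aestronglyMeasurable (ae_of_all _ fun ω => ?_)
  have h1 := Real.add_one_le_exp (X ω ^ 2 / K ^ 2)
  have h2 : |X ω| / K ≤ Real.exp (X ω ^ 2 / K ^ 2) := by
    have h3 : X ω ^ 2 / K ^ 2 = (|X ω| / K) ^ 2 := by rw [div_pow, sq_abs]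
    rw [h3] at h1 ⊢
    nlinarith [sq_nonneg (|X ω| / K - 1)]
  rw [div_le_iff₀ hK] at h2
  rw [Real.norm_eq_abs]
  linarith

theorem exp_mul_le_mul_exp_sq {K : ℝ} (hK : 0 < K) (l y : ℝ) :
    Real.exp (l * y) ≤ Real.exp (l ^ 2 * K ^ 2 / 4) * Real.exp (y ^ 2 / K ^ 2) := by
  rw [← Real.exp_add, Real.exp_le_exp]
  have h : l ^ 2 * K ^ 2 / 4 + y ^ 2 / K ^ 2 - l * y = (l * K / 2 - y / K) ^ 2 := by
    field_simp; ring
  nlinarith [sq_nonneg (l * K / 2 - y / K)]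

theorem integrable_exp_mul_of_integrable_exp_sq {X : Ω → ℝ} {K : ℝ} (hK : 0 < K)
    (hX : Measurable X) (hint : Integrable (fun ω => Real.exp (X ω ^ 2 / K ^ 2)) μ) (l : ℝ) :
    Integrable (fun ω => Real.exp (l * X ω)) μ := by
  refine (hint.const_mul (Real.exp (l ^ 2 * K ^ 2 / 4))).mono'
    (hX.const_mul l).exp.aestronglyMeasurable (ae_of_all _ fun ω => ?_)
  rw [Real.norm_eq_abs, abs_of_pos (Real.exp_pos _)]
  exact exp_mul_le_mul_exp_sq hK l _

variable [IsProbabilityMeasure μ]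

/-- For small `l`, `exp y ≤ y + exp (y²)` leaves a linear term that the zero mean kills. For large
`l`, the Young inequality `lX ≤ l²K²/2 + X²/(2K²)` suffices. In both regimes convexity of `exp`
brings the exponent back to `X²/K²`. -/
theorem integral_exp_mul_le {X : Ω → ℝ} {K σ : ℝ} (hK : 0 < K) (hX : Measurable X)
    (hmean : ∫ ω, X ω ∂μ = 0)
    (hint : Integrable (fun ω => Real.exp (X ω ^ 2 / K ^ 2)) μ)
    (hle : K ^ 2 * ((∫ ω, Real.exp (X ω ^ 2 / K ^ 2) ∂μ) - 1) ≤ σ ^ 2) (l : ℝ) :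
    ∫ ω, Real.exp (l * X ω) ∂μ ≤ Real.exp (l ^ 2 * (K ^ 2 + σ ^ 2)) := by
  have hXint := integrable_of_integrable_exp_sq hK hX hint
  have hlint : Integrable (fun ω => Real.exp (l * X ω)) μ :=
    integrable_exp_mul_of_integrable_exp_sq hK hX hint l
  have hconst (c θ : ℝ) : Integrable
      (fun ω => c * X ω + (1 + θ * (Real.exp (X ω ^ 2 / K ^ 2) - 1))) μ :=
    (hXint.const_mul c).add ((integrable_const _).add ((hint.sub (integrable_const _)).const_mul θ))
  have heval (c θ : ℝ) : ∫ ω, c * X ω + (1 + θ * (Real.exp (X ω ^ 2 / K ^ 2) - 1)) ∂μ =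
      1 + θ * ((∫ ω, Real.exp (X ω ^ 2 / K ^ 2) ∂μ) - 1) := by
    have i1 : Integrable (fun ω => Real.exp (X ω ^ 2 / K ^ 2) - 1) μ :=
      hint.sub (integrable_const _)
    have i2 : Integrable (fun ω => 1 + θ * (Real.exp (X ω ^ 2 / K ^ 2) - 1)) μ :=
      (integrable_const _).add (i1.const_mul θ)
    rw [integral_add (hXint.const_mul c) i2, integral_add (integrable_const _) (i1.const_mul θ),
      integral_const_mul, integral_const_mul, integral_sub hint (integrable_const _), hmean]
    simp
  have hK2 : 0 < K ^ 2 := by positivity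
  set J := (∫ ω, Real.exp (X ω ^ 2 / K ^ 2) ∂μ) - 1
  rcases le_total (l ^ 2 * K ^ 2) 1 with h | h
  · calc ∫ ω, Real.exp (l * X ω) ∂μ
        ≤ ∫ ω, l * X ω + (1 + l ^ 2 * K ^ 2 * (Real.exp (X ω ^ 2 / K ^ 2) - 1)) ∂μ := by
          refine integral_mono hlint (hconst _ _) fun ω => ?_
          have h1 := exp_le_add_exp_sq (l * X ω)
          have h2 := exp_mul_le_one_add_mul (by positivity) h (X ω ^ 2 / K ^ 2)
          have h3 : l ^ 2 * K ^ 2 * (X ω ^ 2 / K ^ 2) = (l * X ω) ^ 2 := by field_simp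
          rw [h3] at h2
          exact h1.trans (by linarith)
      _ = 1 + l ^ 2 * K ^ 2 * J := heval _ _
      _ ≤ l ^ 2 * (K ^ 2 + σ ^ 2) + 1 := by
          nlinarith [mul_le_mul_of_nonneg_left hle (sq_nonneg l), mul_nonneg (sq_nonneg l) hK2.le]
      _ ≤ _ := Real.add_one_le_exp _
  · calc ∫ ω, Real.exp (l * X ω) ∂μ
        ≤ ∫ ω, Real.exp (l ^ 2 * K ^ 2 / 2) *
            (0 * X ω + (1 + (1 / 2) * (Real.exp (X ω ^ 2 / K ^ 2) - 1))) ∂μ := by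
          refine integral_mono hlint ((hconst _ _).const_mul _) fun ω => ?_
          have h2 := exp_mul_le_one_add_mul (by norm_num : (0 : ℝ) ≤ 1 / 2) (by norm_num)
            (X ω ^ 2 / K ^ 2)
          calc Real.exp (l * X ω)
              ≤ Real.exp (l ^ 2 * K ^ 2 / 2) * Real.exp (1 / 2 * (X ω ^ 2 / K ^ 2)) := by
                rw [← Real.exp_add, Real.exp_le_exp]
                have h : l ^ 2 * K ^ 2 / 2 + 1 / 2 * (X ω ^ 2 / K ^ 2) - l * X ω
                    = (l * K - X ω / K) ^ 2 / 2 := by field_simp; ring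
                nlinarith [sq_nonneg (l * K - X ω / K)]
            _ ≤ _ := by
                gcongr
                linarith
      _ = Real.exp (l ^ 2 * K ^ 2 / 2) * (1 + 1 / 2 * J) := by
          rw [integral_const_mul, heval]
      _ ≤ Real.exp (l ^ 2 * K ^ 2 / 2) * Real.exp (l ^ 2 * σ ^ 2 / 2) := by
          gcongr
          have h3 : J ≤ l ^ 2 * σ ^ 2 := by
            have hJ : J ≤ σ ^ 2 / K ^ 2 := by rw [le_div_iff₀ hK2]; linarith
            refine hJ.trans ?_
            rw [div_le_iff₀ hK2]
            nlinarith [mul_le_mul_of_nonneg_left h (sq_nonneg σ)]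
          have := Real.add_one_le_exp (l ^ 2 * σ ^ 2 / 2)
          linarith
      _ ≤ _ := by
          rw [← Real.exp_add, Real.exp_le_exp]
          nlinarith [mul_nonneg (sq_nonneg l) hK2.le, mul_nonneg (sq_nonneg l) (sq_nonneg σ)]

theorem hasSubgaussianMGF_of_integral_exp_sq {X : Ω → ℝ} {K σ : ℝ} (hK : 0 < K)
    (hX : Measurable X) (hmean : ∫ ω, X ω ∂μ = 0)
    (hint : Integrable (fun ω => Real.exp (X ω ^ 2 / K ^ 2)) μ)
    (hle : K ^ 2 * ((∫ ω, Real.exp (X ω ^ 2 / K ^ 2) ∂μ) - 1) ≤ σ ^ 2) :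
    HasSubgaussianMGF X (Real.toNNReal (2 * (K ^ 2 + σ ^ 2))) μ where
  integrable_exp_mul l := integrable_exp_mul_of_integrable_exp_sq hK hX hint l
  mgf_le l := by
    refine (integral_exp_mul_le hK hX hmean hint hle l).trans (Real.exp_le_exp.2 ?_)
    rw [Real.coe_toNNReal _ (by positivity)]
    linarith

theorem measureReal_abs_weighted_sum_ge_le {n : ℕ} {ε : Fin n → Ω → ℝ} {K σ : ℝ} (hK : 0 < K)
    (hm : ∀ i, Measurable (ε i)) (hind : iIndepFun ε μ) (hmean : ∀ i, ∫ ω, ε i ω ∂μ = 0)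
    (hsub : SubGaussianErrors μ ε K σ) (w : Fin n → ℝ) {R v : ℝ} (hR : 0 < R)
    (hw : ∑ i, w i ^ 2 ≤ R ^ 2) (hv : 0 ≤ v) :
    μ.real {ω | R * (2 * Real.sqrt (K ^ 2 + σ ^ 2)) * v ≤ |∑ i, ε i ω * w i|} ≤
      2 * Real.exp (-v ^ 2) := by
  have hτ : 0 < K ^ 2 + σ ^ 2 := by positivity
  set τ := K ^ 2 + σ ^ 2 with hτdef
  have hone : ∀ w : Fin n → ℝ, ∑ i, w i ^ 2 ≤ R ^ 2 →
      μ.real {ω | R * (2 * Real.sqrt τ) * v ≤ ∑ i, w i * ε i ω} ≤ Real.exp (-v ^ 2) := by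
    intro w hw
    have hS := HasSubgaussianMGF.sum_of_iIndepFun (μ := μ) (X := fun i ω => w i * ε i ω)
      (c := fun i => NNReal.mk (w i ^ 2) (sq_nonneg _) * Real.toNNReal (2 * τ)) (s := Finset.univ)
      (hind.comp (fun i y => w i * y) fun i => measurable_const_mul (w i))
      (fun i _ => (hasSubgaussianMGF_of_integral_exp_sq hK (hm i) (hmean i) (hsub i).1
        (hsub i).2).const_mul (w i))
    have hS' : HasSubgaussianMGF (fun ω => ∑ i, w i * ε i ω) (Real.toNNReal (R ^ 2 * (2 * τ))) μ := by
      refine ⟨hS.integrable_exp_mul, fun l => (hS.mgf_le l).trans (Real.exp_le_exp.2 ?_)⟩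
      rw [Real.coe_toNNReal _ (by positivity)]
      gcongr
      simp only [NNReal.coe_sum, NNReal.coe_mul, NNReal.coe_mk]
      rw [Real.coe_toNNReal _ (by positivity), ← Finset.sum_mul]
      gcongr
    refine (hS'.measure_ge_le (by positivity)).trans (Real.exp_le_exp.2 (le_of_eq ?_))
    rw [Real.coe_toNNReal _ (by positivity), mul_pow, mul_pow, mul_pow, Real.sq_sqrt hτ.le]
    field_simp
  have h1 := hone w hw
  -- The lower tail is the upper tail for the weights `-w`.
  have h2 := hone (fun i => -w i) (by simpa using hw)
  calc _ ≤ μ.real ({ω | R * (2 * Real.sqrt τ) * v ≤ ∑ i, w i * ε i ω} ∪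
        {ω | R * (2 * Real.sqrt τ) * v ≤ ∑ i, -w i * ε i ω}) := by
        refine measureReal_mono (fun ω hω => ?_)
        simp only [Set.mem_ofPred_eq, le_abs, Set.mem_union] at hω ⊢
        simpa [mul_comm, Finset.sum_neg_distrib] using hω
    _ ≤ _ := (measureReal_union_le _ _).trans (by linarith)

end SubGaussian

/-! ### The empirical seminorm and linear functions. -/

section EmpiricalNorm

variable {𝒳 : Type*} {n p : ℕ}

theorem empNorm_eq_norm (x : Fin n → 𝒳) (f : 𝒳 → ℝ) :
    empNorm x f = ‖WithLp.toLp 2 (f ∘ x)‖ / Real.sqrt n := by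
  rw [empNorm, Real.sqrt_div' _ (Nat.cast_nonneg n), EuclideanSpace.norm_eq]
  simp

theorem empNorm_nonneg (x : Fin n → 𝒳) (f : 𝒳 → ℝ) : 0 ≤ empNorm x f := Real.sqrt_nonneg _

theorem empNorm_add_le (x : Fin n → 𝒳) (f g : 𝒳 → ℝ) :
    empNorm x (f + g) ≤ empNorm x f + empNorm x g := by
  simp only [empNorm_eq_norm, ← add_div]
  gcongr
  exact norm_add_le (WithLp.toLp 2 (f ∘ x)) (WithLp.toLp 2 (g ∘ x))

theorem empNorm_smul (x : Fin n → 𝒳) (c : ℝ) (f : 𝒳 → ℝ) :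
    empNorm x (c • f) = |c| * empNorm x f := by
  simp only [empNorm_eq_norm, ← mul_div_assoc]
  congr 1
  exact norm_smul c (WithLp.toLp 2 (f ∘ x))

theorem empNorm_sub_comm (x : Fin n → 𝒳) (f g : 𝒳 → ℝ) :
    empNorm x (f - g) = empNorm x (g - f) := by
  rw [← neg_sub, ← neg_one_smul ℝ, empNorm_smul]
  simp

theorem sum_sq_eq (hn : 0 < n) (x : Fin n → 𝒳) (f : 𝒳 → ℝ) :
    ∑ i, f (x i) ^ 2 = (Real.sqrt n * empNorm x f) ^ 2 := by
  have : (0 : ℝ) < n := by exact_mod_cast hn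
  rw [mul_pow, empNorm, Real.sq_sqrt (by positivity), Real.sq_sqrt (by positivity)]
  field_simp

theorem abs_sum_mul_le (hn : 0 < n) (x : Fin n → 𝒳) (e : Fin n → ℝ) (f : 𝒳 → ℝ) :
    |∑ i, e i * f (x i)| ≤ Real.sqrt (∑ i, e i ^ 2) * (Real.sqrt n * empNorm x f) := by
  have h := Finset.sum_mul_sq_le_sq_mul_sq Finset.univ e (fun i => f (x i))
  rw [sum_sq_eq hn x f] at h
  have h0 : 0 ≤ Real.sqrt n * empNorm x f := mul_nonneg (Real.sqrt_nonneg _) (empNorm_nonneg _ _)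
  refine abs_le_of_sq_le_sq (h.trans_eq ?_) (by positivity)
  rw [mul_pow (Real.sqrt (∑ i, e i ^ 2)), Real.sq_sqrt (by positivity)]

theorem linFun_eq_sum (ψ : Fin p → 𝒳 → ℝ) (β : Fin p → ℝ) :
    linFun ψ β = ∑ j, β j • ψ j := by
  ext z
  simp [linFun, mul_comm]

theorem linFun_smul (ψ : Fin p → 𝒳 → ℝ) (c : ℝ) (β : Fin p → ℝ) :
    linFun ψ (c • β) = c • linFun ψ β := by
  simp only [linFun_eq_sum, Finset.smul_sum, Pi.smul_apply, smul_eq_mul, mul_smul]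

theorem l1Norm_smul (c : ℝ) (β : Fin p → ℝ) : l1Norm (c • β) = |c| * l1Norm β := by
  simp [l1Norm, Finset.mul_sum, abs_mul]

theorem l1Norm_pos {β : Fin p → ℝ} (hβ : β ≠ 0) : 0 < l1Norm β := by
  obtain ⟨j, hj⟩ := Function.ne_iff.1 hβ
  exact Finset.sum_pos' (fun _ _ => abs_nonneg _) ⟨j, Finset.mem_univ _, abs_pos.2 hj⟩

theorem empNorm_linFun_le {x : Fin n → 𝒳} {ψ : Fin p → 𝒳 → ℝ}
    (hψ : ∀ j, empNorm x (ψ j) ≤ 1) (β : Fin p → ℝ) :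
    empNorm x (linFun ψ β) ≤ l1Norm β := by
  rw [linFun_eq_sum]
  calc empNorm x (∑ j, β j • ψ j) ≤ ∑ j, empNorm x (β j • ψ j) :=
        Finset.le_sum_of_subadditive (empNorm x) (by simp [empNorm]) (empNorm_add_le x) _ _
    _ ≤ l1Norm β := Finset.sum_le_sum fun j _ => by
        rw [empNorm_smul]
        exact mul_le_of_le_one_right (abs_nonneg _) (hψ j)

end EmpiricalNorm

/-! ### From the entropy condition to finite nets. -/

section Covering

variable {𝒳 : Type*} {n : ℕ}

theorem exists_covering_of_log_coveringNumber_le {x : Fin n → 𝒳} {δ L : ℝ} {F : Set (𝒳 → ℝ)}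
    (h : ENNReal.log (1 + 2 * (coveringNumber x δ F : ℝ≥0∞)) ≤ (L : EReal)) :
    ∃ C : Finset (𝒳 → ℝ), IsCovering x δ F C ∧ 1 + 2 * (C.card : ℝ) ≤ Real.exp L := by
  have htop : coveringNumber x δ F ≠ ⊤ := by
    intro htop
    rw [htop] at h
    simp at h
  obtain ⟨N, hN⟩ := ENat.ne_top_iff_exists.1 htop
  -- An infimum below `N + 1` yields a net of at most `N` elements, so the infimum is attained.
  have hlt : coveringNumber x δ F < ((N + 1 : ℕ) : ℕ∞) := by
    rw [← hN]; exact_mod_cast Nat.lt_succ_self N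
  simp only [coveringNumber, iInf_lt_iff] at hlt
  obtain ⟨C, hC, hcard⟩ := hlt
  have hcard' : C.card ≤ N := Nat.lt_succ_iff.1 (by exact_mod_cast hcard)
  refine ⟨C, hC, ?_⟩
  have h2 : (1 : ℝ≥0∞) + 2 * ((N : ℕ∞) : ℝ≥0∞) = ENNReal.ofReal (1 + 2 * (N : ℝ)) := by
    rw [ENNReal.ofReal_add (by norm_num) (by positivity), ENNReal.ofReal_mul (by norm_num)]
    simp
  rw [← hN, h2, ENNReal.log_ofReal_of_pos (by positivity), EReal.coe_le_coe_iff,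
    Real.log_le_iff_le_exp (by positivity)] at h
  have : (C.card : ℝ) ≤ N := by exact_mod_cast hcard'
  linarith

end Covering

/-! ### Chaining within shells and the union bound. -/

section Chaining

variable {𝒳 : Type*} {n : ℕ}

/-- The links telescope, and for a fixed `e` the remainder vanishes in the limit by Cauchy–Schwarz.
-/
theorem abs_sum_mul_le_of_chain (hn : 0 < n) (x : Fin n → 𝒳) (e : Fin n → ℝ) {f : 𝒳 → ℝ}
    {φ : ℕ → 𝒳 → ℝ} (h0 : φ 0 = 0)
    (hlim : Filter.Tendsto (fun k => empNorm x (f - φ k)) Filter.atTop (nhds 0)) {b : ℕ → ℝ}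
    (hstep : ∀ k, |∑ i, e i * (φ (k + 1) - φ k) (x i)| ≤ b k) {M : ℝ}
    (hM : ∀ m, ∑ k ∈ Finset.range m, b k ≤ M) :
    |∑ i, e i * f (x i)| ≤ M := by
  have hlim' := ((hlim.const_mul (Real.sqrt n)).const_mul (Real.sqrt (∑ i, e i ^ 2))).const_add M
  simp only [mul_zero, add_zero] at hlim'
  refine ge_of_tendsto' hlim' fun m => ?_
  have htel : ∑ k ∈ Finset.range m, ∑ i, e i * (φ (k + 1) - φ k) (x i)
      = ∑ i, e i * φ m (x i) := by
    rw [Finset.sum_comm]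
    refine Finset.sum_congr rfl fun i _ => ?_
    rw [← Finset.mul_sum]
    congr 1
    simpa [h0] using Finset.sum_range_sub (fun k => φ k (x i)) m
  have hsplit : ∑ i, e i * f (x i)
      = ∑ i, e i * φ m (x i) + ∑ i, e i * (f - φ m) (x i) := by
    rw [← Finset.sum_add_distrib]
    exact Finset.sum_congr rfl fun i _ => by simp only [Pi.sub_apply]; ring
  rw [hsplit, ← htel]
  refine (abs_add_le _ _).trans (add_le_add ?_ (abs_sum_mul_le hn x e _))
  exact (Finset.abs_sum_le_sum_abs _ _).trans ((Finset.sum_le_sum fun k _ => hstep k).trans (hM m))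

theorem sum_range_geometric_succ_le {ρ : ℝ} (h0 : 0 ≤ ρ) (h1 : ρ < 1) (m : ℕ) :
    ∑ j ∈ Finset.range m, ρ ^ (j + 1) ≤ ρ / (1 - ρ) := by
  have h : 0 < 1 - ρ := sub_pos.2 h1
  rw [le_div_iff₀ h]
  have : (∑ j ∈ Finset.range m, ρ ^ (j + 1)) * (1 - ρ) = ρ - ρ ^ (m + 1) := by
    induction m with
    | zero => simp
    | succ m ih => rw [Finset.sum_range_succ, add_mul, ih]; ring
  have := pow_nonneg h0 (m + 1)
  linarith

theorem sum_range_succ_mul_half_pow_le (m : ℕ) :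
    ∑ j ∈ Finset.range m, ((j : ℝ) + 1) * (1 / 2) ^ (j + 1) ≤ 2 := by
  have : ∑ j ∈ Finset.range m, ((j : ℝ) + 1) * (1 / 2) ^ (j + 1) = 2 - (m + 2) * (1 / 2) ^ m := by
    induction m with
    | zero => simp
    | succ m ih => rw [Finset.sum_range_succ, ih]; push_cast; ring
  have : (0 : ℝ) ≤ (m + 2) * (1 / 2) ^ m := by positivity
  linarith

/-- The deviation, in units of the standard deviation, that is allowed to the increments of the
`j`-th link of the chain in the shell of radius `2⁻ˢ`. -/
def linkDeviation (a b D t : ℝ) (s j : ℕ) : ℝ := 2 * b * a ^ (s + j + 1) + (j + 1) * (t + D * a ^ s)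

theorem linkDeviation_nonneg {a b D t : ℝ} (ha : 0 ≤ a) (hb : 0 ≤ b) (hD : 0 ≤ D) (ht : 0 ≤ t)
    (s j : ℕ) : 0 ≤ linkDeviation a b D t s j := by
  unfold linkDeviation; positivity

theorem sum_linkDeviation_le {a b D t : ℝ} (ha : 1 < a) (ha2 : a < 2) (hb : 0 ≤ b) (ht : 0 ≤ t)
    (hD : D = b / (2 / a - 1)) (s m : ℕ) :
    ∑ j ∈ Finset.range m, (1 / 2) ^ (s + j + 1) * linkDeviation a b D t s j ≤
      4 * (a / 2) ^ s * (D + t) := by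
  have ha0 : 0 < a := by linarith
  have hD0 : 0 ≤ D := by
    rw [hD]
    refine div_nonneg hb (sub_nonneg.2 ?_)
    rw [le_div_iff₀ ha0]; linarith
  -- `D` is exactly the entropy series `∑ b (a/2)^(j+1)`.
  have hDρ : b * ((a / 2) / (1 - a / 2)) = D := by
    have : 2 - a ≠ 0 := by linarith
    rw [hD]; field_simp
  have hterm : ∀ j, (1 / 2 : ℝ) ^ (s + j + 1) * linkDeviation a b D t s j =
      2 * b * (a / 2) ^ s * (a / 2) ^ (j + 1) +
        ((1 / 2) ^ s * t + D * (a / 2) ^ s) * (((j : ℝ) + 1) * (1 / 2) ^ (j + 1)) := by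
    intro j
    rw [linkDeviation, div_eq_mul_one_div a 2]
    ring
  have hs : (1 / 2 : ℝ) ^ s ≤ (a / 2) ^ s := by gcongr
  simp only [hterm, Finset.sum_add_distrib, ← Finset.mul_sum]
  calc _ ≤ 2 * b * (a / 2) ^ s * ((a / 2) / (1 - a / 2)) +
        ((1 / 2) ^ s * t + D * (a / 2) ^ s) * 2 := by
        gcongr
        · exact sum_range_geometric_succ_le (by positivity) (by linarith) m
        · exact sum_range_succ_mul_half_pow_le m
    _ = 2 * (a / 2) ^ s * (b * ((a / 2) / (1 - a / 2))) +
        ((1 / 2) ^ s * t + D * (a / 2) ^ s) * 2 := by ring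
    _ ≤ _ := by
        rw [hDρ]
        nlinarith [mul_le_mul_of_nonneg_right hs ht, mul_nonneg (pow_nonneg ha0.le s) ht,
          mul_nonneg (pow_nonneg (by positivity : (0 : ℝ) ≤ a / 2) s) ht]

/-- The four terms on the left pay, in order, for the number of increments, the level `t`, the sum
over shells and the sum over links. The last two come from `(D aˢ)²`, once plainly and once with the
factor `j`. -/
theorem linkDeviation_sq_ge {a b D t α : ℝ} (ha : 1 ≤ a) (hb : 0 ≤ b) (hD : 0 ≤ D)
    (ht : 0 ≤ t) (s j : ℕ) (hα : 1 + α * s ≤ (a ^ s) ^ 2) (hbD : b ≤ D) :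
    2 * (b * a ^ (s + j + 1)) ^ 2 + t ^ 2 + α * D ^ 2 / 2 * s + j * b ^ 2 ≤
      linkDeviation a b D t s j ^ 2 := by
  have ha0 : 0 ≤ a := by linarith
  have h1 : (1 : ℝ) ≤ (a ^ s) ^ 2 := one_le_pow₀ (one_le_pow₀ ha)
  set u := b * a ^ (s + j + 1) with hu
  have hu0 : 0 ≤ u := by positivity
  set w := D * a ^ s with hw
  have hw0 : 0 ≤ w := by positivity
  have hw1 : D ^ 2 ≤ w ^ 2 := by rw [hw, mul_pow]; exact le_mul_of_one_le_right (sq_nonneg _) h1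
  have hw2 : D ^ 2 * (1 + α * s) ≤ w ^ 2 := by rw [hw, mul_pow]; gcongr
  have hbD2 : b ^ 2 ≤ D ^ 2 := by gcongr
  have hj : (0 : ℝ) ≤ j := Nat.cast_nonneg j
  have e : linkDeviation a b D t s j = 2 * u + (j + 1) * (t + w) := by
    rw [linkDeviation, hu, hw]; ring
  rw [e]
  have h2 : (1 + 2 * (j : ℝ)) * (t ^ 2 + w ^ 2) ≤ ((j + 1) * (t + w)) ^ 2 := by
    have : (1 + 2 * (j : ℝ)) ≤ (j + 1) ^ 2 := by nlinarith
    have h' : t ^ 2 + w ^ 2 ≤ (t + w) ^ 2 := by nlinarith [mul_nonneg ht hw0]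
    calc (1 + 2 * (j : ℝ)) * (t ^ 2 + w ^ 2) ≤ (j + 1) ^ 2 * (t + w) ^ 2 := by gcongr
      _ = _ := (mul_pow _ _ _).symm
  have h3 : 0 ≤ u * ((j + 1) * (t + w)) := by positivity
  have h4 : (j : ℝ) * b ^ 2 ≤ j * w ^ 2 := mul_le_mul_of_nonneg_left (by linarith) hj
  have h5 : α * D ^ 2 / 2 * s ≤ w ^ 2 := by
    nlinarith [sq_nonneg D, sq_nonneg w]
  nlinarith [mul_nonneg hj (sq_nonneg t), mul_nonneg hj (sq_nonneg w), sq_nonneg u]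

/-- The nets of the chain in the shell of radius `2⁻ˢ`: the origin, followed by the nets `C m` of
radius `2⁻ᵐ`, `m > s`. -/
def shellNet (C : ℕ → Finset (𝒳 → ℝ)) (s k : ℕ) : Finset (𝒳 → ℝ) := if k = 0 then {0} else C (s + k)

open Classical in
/-- The increments of the `j`-th link of the chain in the shell of radius `2⁻ˢ`. -/
noncomputable def shellIncrements (x : Fin n → 𝒳) (C : ℕ → Finset (𝒳 → ℝ)) (s j : ℕ) :
    Finset (𝒳 → ℝ) :=
  ((shellNet C s (j + 1) ×ˢ shellNet C s j).image fun q => q.1 - q.2).filter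
    fun g => empNorm x g ≤ 3 * (1 / 2) ^ (s + j + 1)

theorem card_shellIncrements_le (x : Fin n → 𝒳) {C : ℕ → Finset (𝒳 → ℝ)} {a b : ℝ} (ha : 1 ≤ a)
    (hb : 0 ≤ b) (hb3 : 3 ≤ Real.exp (b ^ 2))
    (hcard : ∀ m, 1 + 2 * ((C m).card : ℝ) ≤ Real.exp ((b * a ^ m) ^ 2)) (s j : ℕ) :
    ((shellIncrements x C s j).card : ℝ) ≤ Real.exp (2 * (b * a ^ (s + j + 1)) ^ 2) / 4 := by
  classical
  have hnet : ∀ k, k ≤ j + 1 →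
      ((shellNet C s k).card : ℝ) ≤ Real.exp ((b * a ^ (s + j + 1)) ^ 2) / 2 := by
    intro k hk
    unfold shellNet
    split_ifs with h
    -- The origin is a net of size one; `hb3` makes it satisfy the same bound as the others.
    · have h1 : Real.exp (b ^ 2) ≤ Real.exp ((b * a ^ (s + j + 1)) ^ 2) := by
        gcongr
        exact le_mul_of_one_le_right hb (one_le_pow₀ ha)
      simp only [Finset.card_singleton, Nat.cast_one]
      linarith
    · have h1 : Real.exp ((b * a ^ (s + k)) ^ 2) ≤ Real.exp ((b * a ^ (s + j + 1)) ^ 2) := by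
        have h2 : a ^ (s + k) ≤ a ^ (s + j + 1) := pow_le_pow_right₀ ha (by omega)
        gcongr
      linarith [hcard (s + k)]
  have h1 : (shellIncrements x C s j).card ≤
      (shellNet C s (j + 1)).card * (shellNet C s j).card :=
    (Finset.card_filter_le _ _).trans (Finset.card_image_le.trans (Finset.card_product _ _).le)
  calc ((shellIncrements x C s j).card : ℝ)
      ≤ (shellNet C s (j + 1)).card * (shellNet C s j).card := by exact_mod_cast h1
    _ ≤ (Real.exp ((b * a ^ (s + j + 1)) ^ 2) / 2) * (Real.exp ((b * a ^ (s + j + 1)) ^ 2) / 2) := by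
        gcongr
        · exact hnet _ le_rfl
        · exact hnet _ (by omega)
    _ = _ := by rw [two_mul, Real.exp_add]; ring

theorem exists_chain {x : Fin n → 𝒳} {F : Set (𝒳 → ℝ)} {C : ℕ → Finset (𝒳 → ℝ)}
    (hC : ∀ m, IsCovering x ((1 / 2) ^ m) F (C m)) {f : 𝒳 → ℝ} (hf : f ∈ F) {s : ℕ}
    (hs : empNorm x f ≤ (1 / 2) ^ s) :
    ∃ φ : ℕ → 𝒳 → ℝ, φ 0 = 0 ∧
      Filter.Tendsto (fun k => empNorm x (f - φ k)) Filter.atTop (nhds 0) ∧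
      ∀ j, φ (j + 1) - φ j ∈ shellIncrements x C s j := by
  classical
  have hex : ∀ k, ∃ g ∈ shellNet C s k, empNorm x (f - g) ≤ (1 / 2) ^ (s + k) := by
    intro k
    unfold shellNet
    split_ifs with h
    · exact ⟨0, by simp, by simpa [h] using hs⟩
    · exact hC (s + k) f hf
  choose φ hφ hφn using hex
  refine ⟨φ, by simpa [shellNet] using hφ 0, ?_, fun j => ?_⟩
  · refine squeeze_zero (fun k => empNorm_nonneg _ _) hφn ?_
    simp only [pow_add]
    simpa using (tendsto_pow_atTop_nhds_zero_of_lt_one (by norm_num : (0 : ℝ) ≤ 1 / 2)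
      (by norm_num)).const_mul ((1 / 2 : ℝ) ^ s)
  · refine Finset.mem_filter.2 ⟨Finset.mem_image.2
      ⟨(φ (j + 1), φ j), Finset.mem_product.2 ⟨hφ _, hφ _⟩, rfl⟩, ?_⟩
    have h : φ (j + 1) - φ j = (φ (j + 1) - f) + (f - φ j) := by abel
    rw [h]
    refine (empNorm_add_le _ _ _).trans ?_
    rw [empNorm_sub_comm]
    have h1 := hφn (j + 1)
    have h2 := hφn j
    rw [← add_assoc] at h1
    -- The 3 in `shellIncrements` is `1 + 2`: the errors of the finer and the coarser approximation.
    have h3 : (1 / 2 : ℝ) ^ (s + j) = 2 * (1 / 2) ^ (s + j + 1) := by rw [pow_succ]; ring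
    linarith

variable {Ω : Type*} [MeasurableSpace Ω] {μ : Measure Ω} [IsProbabilityMeasure μ]

theorem measureReal_exists_abs_sum_ge_le (hn : 0 < n) {x : Fin n → 𝒳} {ε : Fin n → Ω → ℝ}
    {K σ : ℝ} (hK : 0 < K) (hm : ∀ i, Measurable (ε i)) (hind : iIndepFun ε μ)
    (hmean : ∀ i, ∫ ω, ε i ω ∂μ = 0) (hsub : SubGaussianErrors μ ε K σ)
    (P : Finset (𝒳 → ℝ)) {r v : ℝ} (hr : 0 < r) (hP : ∀ g ∈ P, empNorm x g ≤ r) (hv : 0 ≤ v) :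
    μ.real {ω | ∃ g ∈ P, Real.sqrt n * r * (2 * Real.sqrt (K ^ 2 + σ ^ 2)) * v ≤
      |∑ i, ε i ω * g (x i)|} ≤ P.card * (2 * Real.exp (-v ^ 2)) := by
  have hn' : (0 : ℝ) < n := by exact_mod_cast hn
  have hU : {ω | ∃ g ∈ P, Real.sqrt n * r * (2 * Real.sqrt (K ^ 2 + σ ^ 2)) * v ≤
      |∑ i, ε i ω * g (x i)|} = ⋃ g ∈ P, {ω | Real.sqrt n * r *
        (2 * Real.sqrt (K ^ 2 + σ ^ 2)) * v ≤ |∑ i, ε i ω * g (x i)|} := by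
    ext ω; simp
  rw [hU, ← nsmul_eq_mul]
  refine (measureReal_biUnion_finset_le _ _).trans (Finset.sum_le_card_nsmul _ _ _ fun g hg => ?_)
  refine measureReal_abs_weighted_sum_ge_le hK hm hind hmean hsub _ (by positivity) ?_ hv
  rw [sum_sq_eq hn]
  gcongr
  · exact mul_nonneg (Real.sqrt_nonneg _) (empNorm_nonneg _ _)
  · exact hP g hg

theorem exists_measureReal_le_forall_abs_sum_le (hn : 0 < n) {x : Fin n → 𝒳} {F : Set (𝒳 → ℝ)}
    {ε : Fin n → Ω → ℝ} {K σ : ℝ} (hK : 0 < K)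
    (hm : ∀ i, Measurable (ε i)) (hind : iIndepFun ε μ) (hmean : ∀ i, ∫ ω, ε i ω ∂μ = 0)
    (hsub : SubGaussianErrors μ ε K σ) {C : ℕ → Finset (𝒳 → ℝ)}
    (hC : ∀ m, IsCovering x ((1 / 2) ^ m) F (C m)) {a b D t α : ℝ} (ha : 1 < a) (ha2 : a < 2)
    (hb : 0 < b) (hb3 : 3 ≤ Real.exp (b ^ 2)) (hD : D = b / (2 / a - 1)) (ht : 0 ≤ t)
    (hα : 0 < α) (haα : ∀ s : ℕ, 1 + α * s ≤ (a ^ s) ^ 2)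
    (hcard : ∀ m, 1 + 2 * ((C m).card : ℝ) ≤ Real.exp ((b * a ^ m) ^ 2)) :
    ∃ S : Set Ω, μ.real S ≤ Real.exp (-t ^ 2) * (1 - Real.exp (-(α * D ^ 2 / 2)))⁻¹ ∧
      ∀ ω ∉ S, ∀ f ∈ F, ∀ s : ℕ, empNorm x f ≤ (1 / 2) ^ s →
        |∑ i, ε i ω * f (x i)| ≤
          24 * (Real.sqrt n * Real.sqrt (K ^ 2 + σ ^ 2)) * (a / 2) ^ s * (D + t) := by
  have ha0 : 0 < a := by linarith
  have h2a : 0 < 2 / a - 1 := by rw [sub_pos, lt_div_iff₀ ha0]; linarith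
  have h2a' : 2 / a - 1 ≤ 1 := by rw [sub_le_iff_le_add, div_le_iff₀ ha0]; linarith
  have hD0 : 0 < D := by rw [hD]; positivity
  have hbD : b ≤ D := by rw [hD, le_div_iff₀ h2a]; nlinarith
  set q := Real.exp (-(α * D ^ 2 / 2)) with hq
  have hq0 : 0 < q := Real.exp_pos _
  have hq1 : q < 1 := Real.exp_lt_one_iff.2 (by rw [neg_lt_zero]; positivity)
  set τ := Real.sqrt (K ^ 2 + σ ^ 2) with hτ
  let r : ℕ → ℕ → ℝ := fun s j => 3 * (1 / 2) ^ (s + j + 1)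
  let S : ℕ → ℕ → Set Ω := fun s j => {ω | ∃ g ∈ shellIncrements x C s j,
    Real.sqrt n * r s j * (2 * τ) * linkDeviation a b D t s j ≤ |∑ i, ε i ω * g (x i)|}
  have hS : ∀ s j, μ (S s j) ≤
      ENNReal.ofReal (Real.exp (-t ^ 2) * q ^ s * (1 / 2 * (1 / 2) ^ j)) := by
    intro s j
    rw [← ofReal_measureReal]
    refine ENNReal.ofReal_le_ofReal ?_
    refine (measureReal_exists_abs_sum_ge_le hn hK hm hind hmean hsub (shellIncrements x C s j)
      (by positivity) (fun g hg => (Finset.mem_filter.1 hg).2)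
      (linkDeviation_nonneg ha0.le hb.le hD0.le ht s j)).trans ?_
    have hv := linkDeviation_sq_ge (α := α) ha.le hb.le hD0.le ht s j (haα s) hbD
    -- This makes the sum over links geometric with ratio at most `1/2`.
    have he : Real.exp (-(b ^ 2)) ≤ 1 / 2 := by
      rw [Real.exp_neg, one_div]
      exact inv_anti₀ (by norm_num) (by linarith)
    calc ((shellIncrements x C s j).card : ℝ) * (2 * Real.exp (-linkDeviation a b D t s j ^ 2))
        ≤ Real.exp (2 * (b * a ^ (s + j + 1)) ^ 2) / 4 * (2 * Real.exp
            (-(2 * (b * a ^ (s + j + 1)) ^ 2) + (-t ^ 2) + s * (-(α * D ^ 2 / 2)) +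
              j * (-(b ^ 2)))) := by
          gcongr
          · exact card_shellIncrements_le x ha.le hb.le hb3 hcard s j
          · linarith
      _ = Real.exp (-t ^ 2) * q ^ s * (1 / 2 * Real.exp (-(b ^ 2)) ^ j) := by
          rw [Real.exp_add, Real.exp_add, Real.exp_add, Real.exp_nat_mul, Real.exp_nat_mul,
            Real.exp_neg (2 * _), ← hq]
          field_simp
          norm_num
      _ ≤ _ := by gcongr
  refine ⟨⋃ s, ⋃ j, S s j, ?_, ?_⟩
  · have hsum : μ (⋃ s, ⋃ j, S s j) ≤ ENNReal.ofReal (Real.exp (-t ^ 2) * (1 - q)⁻¹) := by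
      refine (measure_iUnion_le _).trans ?_
      have hinner : ∀ s, μ (⋃ j, S s j) ≤ ENNReal.ofReal (Real.exp (-t ^ 2) * q ^ s) := by
        intro s
        refine (measure_iUnion_le _).trans ((ENNReal.tsum_le_tsum (hS s)).trans_eq ?_)
        have hs : HasSum (fun j : ℕ => Real.exp (-t ^ 2) * q ^ s * (1 / 2 * (1 / 2) ^ j))
            (Real.exp (-t ^ 2) * q ^ s * (1 / 2 * 2)) :=
          (hasSum_geometric_two.mul_left _).mul_left _
        rw [← ENNReal.ofReal_tsum_of_nonneg (fun j => by positivity) hs.summable, hs.tsum_eq]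
        norm_num
      refine (ENNReal.tsum_le_tsum hinner).trans_eq ?_
      have hs := (hasSum_geometric_of_lt_one hq0.le hq1).mul_left (Real.exp (-t ^ 2))
      rw [← ENNReal.ofReal_tsum_of_nonneg (fun j => by positivity) hs.summable, hs.tsum_eq]
    exact ENNReal.toReal_le_of_le_ofReal
      (mul_nonneg (Real.exp_pos _).le (inv_nonneg.2 (by linarith))) hsum
  · intro ω hω f hf s hs
    simp only [Set.mem_iUnion, not_exists] at hω
    obtain ⟨φ, h0, hlim, hmem⟩ := exists_chain hC hf hs
    refine abs_sum_mul_le_of_chain hn x (fun i => ε i ω) h0 hlim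
      (b := fun j => Real.sqrt n * r s j * (2 * τ) * linkDeviation a b D t s j) (fun j => ?_)
      fun m => ?_
    · exact le_of_not_ge fun h => hω s j ⟨_, hmem j, h⟩
    · calc ∑ j ∈ Finset.range m, Real.sqrt n * r s j * (2 * τ) * linkDeviation a b D t s j
          = 6 * (Real.sqrt n * τ) * ∑ j ∈ Finset.range m,
              (1 / 2) ^ (s + j + 1) * linkDeviation a b D t s j := by
            rw [Finset.mul_sum]
            exact Finset.sum_congr rfl fun j _ => by simp only [r]; ring
        _ ≤ 6 * (Real.sqrt n * τ) * (4 * (a / 2) ^ s * (D + t)) := by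
            gcongr
            exact sum_linkDeviation_le ha ha2 hb.le ht hD s m
        _ = _ := by ring

end Chaining

end LassoDesign

/-! ### Rescaling to the unit class, peeling, and the constants. -/

theorem mainTheorem2 {𝒳 : Type*} {n p : ℕ} (hn : 0 < n)
    (x : Fin n → 𝒳) (ψ : Fin p → 𝒳 → ℝ)
    (hψ : ∀ j, LassoDesign.empNorm x (ψ j) ≤ 1) :
    (∀ β : Fin p → ℝ, LassoDesign.empNorm x (LassoDesign.linFun ψ β) ≤ LassoDesign.l1Norm β) ∧
    (∀ β : Fin p → ℝ, β ≠ 0 →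
      LassoDesign.empNorm x ((LassoDesign.l1Norm β)⁻¹ • LassoDesign.linFun ψ β) ≤ 1) ∧
    ∀ (A α : ℝ), 0 < A → 0 < α → α < 1 →
      LassoDesign.EntropyBound x (LassoDesign.unitClass ψ) A α →
      ∀ {Ω : Type*} [MeasurableSpace Ω] (μ : Measure Ω) [IsProbabilityMeasure μ]
        (ε : Fin n → Ω → ℝ) (K σ₀ : ℝ), 0 < K → 0 < σ₀ →
        (∀ i, Measurable (ε i)) → iIndepFun ε μ → (∀ i, ∫ ω, ε i ω ∂μ = 0) →
        LassoDesign.SubGaussianErrors μ ε K σ₀ →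
        ∀ t : ℝ, 0 < t →
          1 - Real.exp (-t ^ 2) * (1 + 2 / LassoDesign.B A α) ≤
            μ.real (LassoDesign.eventT x ψ ε α (LassoDesign.lam₀ n K σ₀ A α t)) := by
  open LassoDesign in
  have hn' : (0 : ℝ) < n := by exact_mod_cast hn
  refine ⟨empNorm_linFun_le hψ, fun β hβ => ?_, ?_⟩
  · have h := l1Norm_pos hβ
    rw [empNorm_smul, abs_of_pos (inv_pos.2 h), inv_mul_le_iff₀ h, mul_one]
    exact empNorm_linFun_le hψ β
  intro A α hA hα hα1 hent Ω _ μ _ ε K σ₀ hK hσ hm hind hmean hsub t ht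
  set a : ℝ := 2 ^ α with ha
  set b : ℝ := A ^ α with hb
  have ha1 : 1 < a := Real.one_lt_rpow (by norm_num) hα
  have ha2 : a < 2 := by
    simpa using Real.rpow_lt_rpow_of_exponent_lt (by norm_num : (1 : ℝ) < 2) hα1
  have ha0 : 0 < a := by linarith
  have hb0 : 0 < b := Real.rpow_pos_of_pos hA _
  have h2a : (2 : ℝ) ^ (1 - α) = 2 / a := by rw [Real.rpow_sub (by norm_num), Real.rpow_one]
  have h2a1 : 0 < 2 / a - 1 := by rw [sub_pos, lt_div_iff₀ ha0]; linarith
  have hA2 : A ^ (2 * α) = b ^ 2 := by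
    rw [mul_comm, Real.rpow_mul hA.le]; norm_cast
  set D : ℝ := b / (2 / a - 1) with hD
  have hD0 : 0 < D := by positivity
  set τ := Real.sqrt (K ^ 2 + σ₀ ^ 2) with hτ
  have hB : B A α = Real.exp (α * D ^ 2 / 2) - 1 := by
    rw [B, hA2, h2a, hD]
    congr 2
    field_simp
  have hB0 : 0 < B A α := by
    rw [hB, sub_pos]; exact Real.one_lt_exp_iff.2 (by positivity)
  have hlam : lam₀ n K σ₀ A α t = 4 * (96 * τ) / Real.sqrt n * (D + t) := by
    rw [lam₀, K₀, h2a]; norm_num [hD, hτ, hb]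
  have hlam0 : 0 ≤ lam₀ n K σ₀ A α t := by rw [hlam]; positivity
  have hsuff : ∀ ω, (∀ f ∈ unitClass ψ, 0 < empNorm x f → |∑ i, ε i ω * f (x i)| ≤
      96 * (Real.sqrt n * τ) * (D + t) * empNorm x f ^ (1 - α)) →
      ω ∈ eventT x ψ ε α (lam₀ n K σ₀ A α t) := by
    intro ω h
    refine iSup_le fun β => EReal.coe_le_coe_iff.2 ?_
    rcases eq_or_ne (empNorm x (linFun ψ β)) 0 with h0 | h0
    · rw [h0, Real.zero_rpow (by linarith), zero_mul, div_zero]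
      exact hlam0
    have hf0 : 0 < empNorm x (linFun ψ β) := lt_of_le_of_ne (empNorm_nonneg _ _) h0.symm
    have hl0 : 0 < l1Norm β := hf0.trans_le (empNorm_linFun_le hψ β)
    have hmem : linFun ψ ((l1Norm β)⁻¹ • β) ∈ unitClass ψ :=
      ⟨_, by rw [l1Norm_smul, abs_of_pos (inv_pos.2 hl0), inv_mul_cancel₀ hl0.ne'], rfl⟩
    have hnorm : empNorm x (linFun ψ ((l1Norm β)⁻¹ • β)) =
        (l1Norm β)⁻¹ * empNorm x (linFun ψ β) := by
      rw [linFun_smul, empNorm_smul, abs_of_pos (inv_pos.2 hl0)]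
    have h1 := h _ hmem (by rw [hnorm]; positivity)
    have hsum : ∑ i, ε i ω * linFun ψ ((l1Norm β)⁻¹ • β) (x i) =
        (l1Norm β)⁻¹ * ∑ i, ε i ω * linFun ψ β (x i) := by
      rw [linFun_smul, Finset.mul_sum]
      exact Finset.sum_congr rfl fun i _ => by simp only [Pi.smul_apply, smul_eq_mul]; ring
    have hpow : l1Norm β * ((l1Norm β)⁻¹ * empNorm x (linFun ψ β)) ^ (1 - α) =
        empNorm x (linFun ψ β) ^ (1 - α) * l1Norm β ^ α := by
      rw [Real.mul_rpow (by positivity) hf0.le, Real.inv_rpow hl0.le, Real.rpow_sub hl0,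
        Real.rpow_one]
      have := (Real.rpow_pos_of_pos hl0 α).ne'
      field_simp
    rw [hsum, hnorm, abs_mul, abs_of_pos (inv_pos.2 hl0), inv_mul_le_iff₀ hl0] at h1
    have hden : 0 < empNorm x (linFun ψ β) ^ (1 - α) * l1Norm β ^ α := by positivity
    rw [div_le_iff₀ hden, div_le_iff₀ hn', hlam, ← hpow]
    calc 4 * |∑ i, ε i ω * linFun ψ β (x i)|
        ≤ 4 * (l1Norm β * (96 * (Real.sqrt n * τ) * (D + t) *
            ((l1Norm β)⁻¹ * empNorm x (linFun ψ β)) ^ (1 - α))) := by gcongr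
      _ = _ := by
        linear_combination (-(384 * τ * (D + t) * (l1Norm β *
          ((l1Norm β)⁻¹ * empNorm x (linFun ψ β)) ^ (1 - α)))) * Real.div_sqrt (x := n)
  -- The class is empty for `p = 0`; otherwise every net is nonempty, which `hb3` needs.
  rcases (unitClass ψ).eq_empty_or_nonempty with hF | ⟨f₀, hf₀⟩
  · have : eventT x ψ ε α (lam₀ n K σ₀ A α t) = Set.univ :=
      Set.eq_univ_of_forall fun ω => hsuff ω (by simp [hF])
    rw [this, probReal_univ, sub_le_self_iff]
    positivity
  have hcov : ∀ m : ℕ, ∃ C : Finset (𝒳 → ℝ), IsCovering x ((1 / 2) ^ m) (unitClass ψ) C ∧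
      1 + 2 * (C.card : ℝ) ≤ Real.exp ((b * a ^ m) ^ 2) := by
    intro m
    have h := hent ((1 / 2) ^ m) (by positivity) (pow_le_one₀ (by norm_num) (by norm_num))
    obtain ⟨C, hC, hcard⟩ := exists_covering_of_log_coveringNumber_le h
    refine ⟨C, hC, hcard.trans_eq ?_⟩
    congr 1
    have e1 : A / (1 / 2) ^ m = A * 2 ^ m := by
      rw [one_div, inv_pow, div_inv_eq_mul]
    rw [e1, mul_comm 2 α, Real.rpow_mul (by positivity), Real.mul_rpow hA.le (by positivity),
      ← Real.rpow_natCast 2 m, ← Real.rpow_mul (by norm_num), mul_comm (m : ℝ) α,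
      Real.rpow_mul (by norm_num), Real.rpow_natCast]
    norm_cast
  choose C hC hcard using hcov
  have hb3 : 3 ≤ Real.exp (b ^ 2) := by
    have h := hcard 0
    obtain ⟨g, hg, -⟩ := hC 0 f₀ hf₀
    have h1 : (1 : ℝ) ≤ (C 0).card := by
      exact_mod_cast Finset.card_pos.2 ⟨g, hg⟩
    rw [pow_zero, mul_one] at h
    linarith
  -- This is `1 + αs ≤ 4^(αs)`, valid because `log 4 ≥ 1`.
  have haα : ∀ s : ℕ, 1 + α * s ≤ (a ^ s) ^ 2 := by
    intro s
    have e : (a ^ s) ^ 2 = Real.exp (2 * (α * s) * Real.log 2) := by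
      rw [ha, ← pow_mul, ← Real.rpow_natCast, ← Real.rpow_mul (by norm_num),
        Real.rpow_def_of_pos (by norm_num)]
      congr 1
      push_cast
      ring
    rw [e]
    have h1 := Real.add_one_le_exp (2 * (α * s) * Real.log 2)
    have h2 : (1 : ℝ) / 2 ≤ Real.log 2 := by linarith [Real.log_two_gt_d9]
    have h3 : 0 ≤ α * s := by positivity
    nlinarith
  have hF1 : ∀ f ∈ unitClass ψ, empNorm x f ≤ 1 := by
    rintro f ⟨β, hβ, rfl⟩
    exact hβ ▸ empNorm_linFun_le hψ β
  obtain ⟨S, hS, hgood⟩ := exists_measureReal_le_forall_abs_sum_le hn hK hm hind hmean hsub hC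
    ha1 ha2 hb0 hb3 hD ht.le hα haα hcard
  have hsubset : Sᶜ ⊆ eventT x ψ ε α (lam₀ n K σ₀ A α t) := by
    intro ω hω
    refine hsuff ω fun f hf hf0 => ?_
    -- The shell of `f`: `2^(-(s+1)) < ‖f‖_n ≤ 2⁻ˢ`.
    obtain ⟨s, hs1, hs2⟩ := exists_nat_pow_near_of_lt_one hf0 (hF1 f hf)
      (by norm_num : (0 : ℝ) < 1 / 2) (by norm_num)
    refine (hgood ω hω f hf s hs2).trans ?_
    have h1 : (a / 2) ^ (s + 1) ≤ empNorm x f ^ (1 - α) := by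
      have e : (a / 2) ^ (s + 1) = ((1 / 2 : ℝ) ^ (s + 1)) ^ (1 - α) := by
        rw [← Real.rpow_natCast (1 / 2), ← Real.rpow_mul (by norm_num), mul_comm,
          Real.rpow_mul (by norm_num), Real.rpow_natCast]
        congr 1
        rw [one_div, Real.inv_rpow (by norm_num), h2a, inv_div]
      rw [e]
      exact Real.rpow_le_rpow (by positivity) hs1.le (by linarith)
    -- As `a / 2 > 1/2`, a factor 2 would do; 4 turns 24 into the `96 = 3 · 2⁵` of `K₀`.
    have h2 : (a / 2) ^ s ≤ 4 * empNorm x f ^ (1 - α) := by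
      rw [pow_succ] at h1
      have : 0 ≤ (a / 2) ^ s := by positivity
      nlinarith
    calc 24 * (Real.sqrt n * τ) * (a / 2) ^ s * (D + t)
        ≤ 24 * (Real.sqrt n * τ) * (4 * empNorm x f ^ (1 - α)) * (D + t) := by gcongr
      _ = _ := by ring
  -- Subadditivity alone, so measurability of `S` or of the event plays no role.
  have hone : 1 ≤ μ.real S + μ.real Sᶜ := by
    rw [← probReal_univ (μ := μ), ← Set.union_compl_self S]
    exact measureReal_union_le _ _
  have hmono := measureReal_mono (μ := μ) hsubset
  have hgeom : (1 - Real.exp (-(α * D ^ 2 / 2)))⁻¹ ≤ 1 + 2 / B A α := by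
    have hE : Real.exp (α * D ^ 2 / 2) = B A α + 1 := by rw [hB]; ring
    rw [Real.exp_neg, hE]
    have e : (1 - (B A α + 1)⁻¹)⁻¹ = 1 + 1 / B A α := by
      have : 1 - (B A α + 1)⁻¹ = B A α / (B A α + 1) := by field_simp; ring
      rw [this, inv_div]; field_simp
    rw [e]
    gcongr
    norm_num
  have := mul_le_mul_of_nonneg_left hgeom (Real.exp_pos (-t ^ 2)).le
  linarith
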